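/- Let $n\ge 0$ and let $f:\mathbb{R}^n\to\mathbb{R}$ belong to the Lelong class, i.e. $f$ is convex and there are $C\ge 0$, $D\in\mathbb{R}$ with $f(x)\le C|x|+D$ for all $x\in\mathbb{R}^n$. For a smooth convex function $u$ on $\mathbb{R}^n$ let $dd^{\#}u=\sum_{i,j=1}^n\frac{\partial^2u}{\partial x_i\partial x_j}\,dx_i\wedge d\xi_j$, an element of the exterior algebra generated by $dx_1,\dots,dx_n,d\xi_1,\dots,d\xi_n$ with coefficients depending on $x$, and let $\omega_n=\frac1{n!}\big(\sum_{i=1}^n dx_i\wedge d\xi_i\big)^n$; a form or current $\mu\,\omega_n$ is identified with $\mu$, so that $(dd^{\#}u)^n$ is a measure with a density. For a convex function $g$ on $\mathbb{R}^n$, $(dd^{\#}g)^n$ (the Monge–Ampère measure of $g$) is the locally finite positive Borel measure that is the limit, tested against continuous functions with compact support, of $(dd^{\#}u_k)^n$ for every sequence of smooth convex functions $u_k$ converging to $g$ uniformly on compact sets; its total mass is denoted $\int_{\mathbb{R}^n\times\mathbb{R}^n}(dd^{\#}g)^n$. Then the limit $$\tilde f(x)=\lim_{t\to\infty}\frac{f(tx)}{t}$$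 exists in $\mathbb{R}$ for every $x\in\mathbb{R}^n$, the measures $(dd^{\#}f)^n$ and $(dd^{\#}\tilde f)^n$ are well defined, and their total masses are finite and equal: $$\int_{\mathbb{R}^n\times\mathbb{R}^n}(dd^{\#}f)^n=\int_{\mathbb{R}^n\times\mathbb{R}^n}(dd^{\#}\tilde f)^n<+\infty .$$ -/

import Mathlib

open Filter Topology MeasureTheory
open scoped ContDiff

/-- The model of `ℝⁿ`, with its Euclidean norm and Lebesgue measure. -/
abbrev RSpace (n : ℕ) : Type := EuclideanSpace ℝ (Fin n)

/-- The algebra of constant-coefficient super forms on `ℝⁿ × ℝⁿ`: the exterior algebra on the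
`2n` generators `dx₁, …, dxₙ, dξ₁, …, dξₙ`. Its product is the wedge product. A super form whose
coefficients depend on `x` only is a function `RSpace n → SuperAlg n`. -/
abbrev SuperAlg (n : ℕ) : Type := ExteriorAlgebra ℝ (Fin n ⊕ Fin n → ℝ)

namespace SuperForm

/-- The generator `dxᵢ`. -/
noncomputable def dx {n : ℕ} (i : Fin n) : SuperAlg n :=
  ExteriorAlgebra.ι ℝ (Pi.single (Sum.inl i) 1)

/-- The generator `dξᵢ = J(dxᵢ)`. -/
noncomputable def dxi {n : ℕ} (i : Fin n) : SuperAlg n :=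
  ExteriorAlgebra.ι ℝ (Pi.single (Sum.inr i) 1)

/-- `ω = ∑ᵢ dxᵢ ∧ dξᵢ`. -/
noncomputable def omega (n : ℕ) : SuperAlg n := ∑ i : Fin n, dx i * dxi i

/-- `ωₙ = ωⁿ / n!`, the positive reference form of bidegree `(n, n)`. -/
noncomputable def omegaTop (n : ℕ) : SuperAlg n := ((n.factorial : ℝ)⁻¹) • omega n ^ n

/-- The partial derivative `∂f/∂xᵢ`. -/
noncomputable def partialDeriv {n : ℕ} (i : Fin n) (f : RSpace n → ℝ) (x : RSpace n) : ℝ :=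
  fderiv ℝ f x (EuclideanSpace.single i 1)

/-- For smooth `f`, the `(1,1)`-form `dd^# f = ∑ᵢⱼ (∂²f/∂xᵢ∂xⱼ) dxᵢ ∧ dξⱼ`, where
`d^# f = ∑ⱼ (∂f/∂xⱼ) dξⱼ` and `d (∑ⱼ gⱼ dξⱼ) = ∑ᵢⱼ (∂gⱼ/∂xᵢ) dxᵢ ∧ dξⱼ`. -/
noncomputable def ddSharp {n : ℕ} (f : RSpace n → ℝ) (x : RSpace n) : SuperAlg n :=
  ∑ i : Fin n, ∑ j : Fin n, partialDeriv i (partialDeriv j f) x • (dx i * dxi j)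

/-! Every `(n,n)`-form `(∑ᵢⱼ Hᵢⱼ dxᵢ ∧ dξⱼ)ⁿ` is a unique multiple of `ωₙ`. -/

section TopDegree

variable {A : Type*} [Ring A]

theorem pow_add_sq_zero (S a : A) (h : Commute S a) (ha : a * a = 0) (k : ℕ) :
    (S + a) ^ (k + 1) = S ^ (k + 1) + (k + 1 : ℕ) • (S ^ k * a) := by
  induction k with
  | zero => simp
  | succ k ih =>
    rw [pow_succ, ih, mul_add, add_mul, add_mul]
    have h1 : S ^ k * a * S = S ^ (k + 1) * a := by
      rw [mul_assoc, ← h.eq, ← mul_assoc, ← pow_succ]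
    have h2 : S ^ k * a * a = 0 := by rw [mul_assoc, ha, mul_zero]
    rw [smul_mul_assoc, smul_mul_assoc, h1, h2, ← pow_succ, smul_zero, add_zero,
      succ_nsmul _ (k + 1)]
    abel

theorem sum_pow_of_sq_zero (m : ℕ) (a : Fin m → A) (hc : ∀ i j, Commute (a i) (a j))
    (ha : ∀ i, a i * a i = 0) :
    (∑ i, a i) ^ (m + 1) = 0 ∧ (∑ i, a i) ^ m = m.factorial • (List.ofFn a).prod := by
  induction m with
  | zero => simp
  | succ m ih =>
    obtain ⟨h1, h2⟩ := ih (fun i => a i.castSucc) (fun i j => hc _ _) (fun i => ha _)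
    have hS : Commute (∑ i : Fin m, a i.castSucc) (a (Fin.last m)) :=
      Commute.sum_left _ _ _ fun i _ => hc _ _
    rw [Fin.sum_univ_castSucc, pow_add_sq_zero _ _ hS (ha _), pow_add_sq_zero _ _ hS (ha _),
      pow_succ (∑ i : Fin m, a i.castSucc) (m + 1), h1, h2]
    refine ⟨by simp, ?_⟩
    rw [List.ofFn_succ', List.concat_eq_append, List.prod_append, Nat.factorial_succ]
    simp [mul_smul, mul_assoc]

end TopDegree

section Exterior

open ExteriorAlgebra

variable {M : Type*} [AddCommGroup M] [Module ℝ M]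

theorem ι_anticomm (a b : M) : ι ℝ a * ι ℝ b = - (ι ℝ b * ι ℝ a) :=
  eq_neg_of_add_eq_zero_left (ExteriorAlgebra.ι_add_mul_swap a b)

theorem commute_pair (a b c d : M) : Commute (ι ℝ a * ι ℝ b) (ι ℝ c * ι ℝ d) := by
  have h : ∀ u, Commute (ι ℝ a * ι ℝ b) (ι ℝ u) := fun u => by
    rw [Commute, SemiconjBy, mul_assoc, ι_anticomm b u, mul_neg, ← mul_assoc, ι_anticomm a u]
    simp [mul_assoc]
  exact (h c).mul_right (h d)

theorem sq_pair (a b : M) : (ι ℝ a * ι ℝ b) * (ι ℝ a * ι ℝ b) = 0 := by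
  rw [mul_assoc, ← mul_assoc (ι ℝ b), ι_anticomm b a]
  simp [← mul_assoc]

theorem mul_ι_prod (m : ℕ) (a : M) (y : Fin m → M) :
    (List.ofFn fun i => ι ℝ (y i)).prod * ι ℝ a =
      (-1 : ℝ) ^ m • (ι ℝ a * (List.ofFn fun i => ι ℝ (y i)).prod) := by
  induction m with
  | zero => simp
  | succ m ih =>
    rw [List.ofFn_succ, List.prod_cons, mul_assoc, ih, mul_smul_comm, ← mul_assoc, ι_anticomm,
      pow_succ]
    simp [mul_assoc]

/-- The sign of the reordering `x₁y₁⋯xₘyₘ = ± x₁⋯xₘ y₁⋯yₘ`. -/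
theorem prod_pairs (m : ℕ) : ∃ s : ℝ, s ≠ 0 ∧ ∀ x y : Fin m → M,
    (List.ofFn fun i => ι ℝ (x i) * ι ℝ (y i)).prod = s • (ιMulti ℝ m x * ιMulti ℝ m y) := by
  induction m with
  | zero => exact ⟨1, one_ne_zero, by simp⟩
  | succ m ih =>
    obtain ⟨s, hs, h⟩ := ih
    refine ⟨s * (-1) ^ m, mul_ne_zero hs (by simp), fun x y => ?_⟩
    simp only [ιMulti_apply] at h ⊢
    rw [List.ofFn_succ', List.ofFn_succ', List.ofFn_succ', List.concat_eq_append,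
      List.concat_eq_append, List.concat_eq_append, List.prod_append, List.prod_append,
      List.prod_append, h (fun i => x i.castSucc) (fun i => y i.castSucc)]
    simp only [List.prod_cons, List.prod_nil, mul_one]
    have := mul_ι_prod m (x (Fin.last m)) (fun i => y i.castSucc)
    rw [smul_mul_assoc, mul_assoc, ← mul_assoc _ (ι ℝ (x (Fin.last m))), this]
    simp [mul_assoc, mul_smul]

end Exterior

/-- `dx₁ ∧ ⋯ ∧ dxₙ ∧ dξ₁ ∧ ⋯ ∧ dξₙ`. -/
noncomputable def dxdxi (n : ℕ) : SuperAlg n :=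
  ExteriorAlgebra.ιMulti ℝ n
      (fun i : Fin n => (Pi.single (Sum.inl i) 1 : Fin n ⊕ Fin n → ℝ)) *
    ExteriorAlgebra.ιMulti ℝ n
      (fun i : Fin n => (Pi.single (Sum.inr i) 1 : Fin n ⊕ Fin n → ℝ))

theorem dxdxi_ne_zero (n : ℕ) : dxdxi n ≠ 0 := by
  let b := (Pi.basisFun ℝ (Fin n ⊕ Fin n)).reindex finSumFinEquiv
  have h : dxdxi n = ExteriorAlgebra.ιMulti ℝ (n + n) b := by
    rw [dxdxi, ExteriorAlgebra.ιMulti_mul_ιMulti]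
    congr 1
    funext k
    refine Fin.addCases (fun i => ?_) (fun i => ?_) k
    · simp [b]
    · rw [Fin.append_right, Module.Basis.reindex_apply, finSumFinEquiv_symm_apply_natAdd,
        Pi.basisFun_apply]
  intro h0
  have h1 := ExteriorAlgebra.liftAlternating_apply_ιMulti
    (Pi.single (n + n) b.det : ∀ i, (Fin n ⊕ Fin n → ℝ) [⋀^Fin i]→ₗ[ℝ] ℝ) b
  rw [← h, h0, map_zero, Pi.single_eq_same, Module.Basis.det_self] at h1
  exact zero_ne_one h1

theorem pow_eq_smul_dxdxi (n : ℕ) : ∃ s : ℝ, s ≠ 0 ∧ ∀ H : Matrix (Fin n) (Fin n) ℝ,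
    (∑ i : Fin n, ∑ j : Fin n, H i j • ((dx i : SuperAlg n) * dxi j)) ^ n =
      ((n.factorial : ℝ) * H.det * s) • dxdxi n := by
  obtain ⟨s, hs0, hs⟩ := prod_pairs (M := Fin n ⊕ Fin n → ℝ) n
  refine ⟨s, hs0, fun H => ?_⟩
  have e1 : ∀ i : Fin n, ∑ j : Fin n, H i j • ((dx i : SuperAlg n) * dxi j) =
      ExteriorAlgebra.ι ℝ (Pi.single (Sum.inl i) 1) *
        ExteriorAlgebra.ι ℝ (∑ j, H i j • Pi.single (Sum.inr j) 1) := by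
    intro i
    simp [dx, dxi, Finset.mul_sum, map_sum]
  simp_rw [e1]
  rw [(sum_pow_of_sq_zero n _ (fun i j => commute_pair _ _ _ _) (fun i => sq_pair _ _)).2, hs]
  let L : (Fin n → ℝ) →ₗ[ℝ] (Fin n ⊕ Fin n → ℝ) :=
    Fintype.linearCombination ℝ (fun j => Pi.single (Sum.inr j) 1)
  have e2 : (ExteriorAlgebra.ιMulti ℝ n).compLinearMap L =
      (LinearMap.toSpanSingleton ℝ _ (ExteriorAlgebra.ιMulti ℝ n
        (fun i : Fin n => (Pi.single (Sum.inr i) 1 : Fin n ⊕ Fin n → ℝ)))).compAlternatingMap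
        (Matrix.detRowAlternating (R := ℝ) (n := Fin n)) := by
    refine Module.Basis.ext_alternating (Pi.basisFun ℝ (Fin n)) fun v hv => ?_
    have hb : Function.Bijective v := Finite.injective_iff_bijective.1 hv
    let σ : Equiv.Perm (Fin n) := Equiv.ofBijective v hb
    have hσ : (fun i => (Pi.basisFun ℝ (Fin n)) (v i)) =
        (fun i => (Pi.basisFun ℝ (Fin n)) i) ∘ σ := rfl
    rw [hσ, AlternatingMap.map_perm, AlternatingMap.map_perm]
    congr 1
    have hone : (Matrix.detRowAlternating (R := ℝ) (n := Fin n))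
        (fun i => (Pi.basisFun ℝ (Fin n)) i) = 1 := by
      rw [← Matrix.det_one (n := Fin n) (R := ℝ)]
      congr 1
      ext i j
      simp [Matrix.one_apply, Pi.single_apply, eq_comm]
    simp only [AlternatingMap.compLinearMap_apply, LinearMap.compAlternatingMap_apply, hone,
      LinearMap.toSpanSingleton_apply, one_smul]
    congr 1
    funext i
    simp [L]
  have e3 := congrArg (fun F : (Fin n → ℝ) [⋀^Fin n]→ₗ[ℝ] SuperAlg n => F (fun i => H i)) e2
  simp only [AlternatingMap.compLinearMap_apply, LinearMap.compAlternatingMap_apply,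
    LinearMap.toSpanSingleton_apply] at e3
  have e4 : (fun i : Fin n => (∑ j, H i j • Pi.single (Sum.inr j) 1 : Fin n ⊕ Fin n → ℝ)) =
      fun i => L (H i) := by
    funext i
    simp [L, Fintype.linearCombination_apply]
  rw [e4, e3, mul_smul_comm, dxdxi, mul_smul, mul_smul, smul_comm s,
    ← Nat.cast_smul_eq_nsmul ℝ]
  rfl

theorem omega_eq (n : ℕ) : omega n =
    ∑ i : Fin n, ∑ j : Fin n, (1 : Matrix (Fin n) (Fin n) ℝ) i j • (dx i * dxi j) := by
  simp [omega, Matrix.one_apply]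

theorem omegaTop_ne_zero (n : ℕ) : omegaTop n ≠ 0 := by
  obtain ⟨s, hs, h⟩ := pow_eq_smul_dxdxi n
  rw [omegaTop, omega_eq, h]
  simp [hs, dxdxi_ne_zero, Nat.factorial_ne_zero]

/-- `(∑ᵢⱼ Hᵢⱼ dxᵢ ∧ dξⱼ)ⁿ = n! det(H) ωₙ`. -/
theorem pow_eq_smul_omegaTop {n : ℕ} (H : Matrix (Fin n) (Fin n) ℝ) :
    (∑ i : Fin n, ∑ j : Fin n, H i j • ((dx i : SuperAlg n) * dxi j)) ^ n =
      ((n.factorial : ℝ) * H.det) • omegaTop n := by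
  obtain ⟨s, -, h⟩ := pow_eq_smul_dxdxi n
  have hn : (n.factorial : ℝ) ≠ 0 := Nat.cast_ne_zero.2 (Nat.factorial_ne_zero n)
  rw [omegaTop, omega_eq, h, h, smul_smul, smul_smul, Matrix.det_one]
  congr 1
  field_simp

theorem existsUnique_density {n : ℕ} (f : RSpace n → ℝ) (x : RSpace n) :
    ∃! c : ℝ, ddSharp f x ^ n = c • omegaTop n :=
  ⟨_, pow_eq_smul_omegaTop (Matrix.of fun i j => partialDeriv i (partialDeriv j f) x),
    fun _ hc => smul_left_injective ℝ (omegaTop_ne_zero n)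
      (hc.symm.trans (pow_eq_smul_omegaTop
        (Matrix.of fun i j => partialDeriv i (partialDeriv j f) x)))⟩

/-- For smooth `f`, the density `g` of the top-degree form `(dd^# f)ⁿ = g ωₙ`. -/
noncomputable def density {n : ℕ} (f : RSpace n → ℝ) (x : RSpace n) : ℝ :=
  (existsUnique_density f x).choose

theorem density_spec {n : ℕ} (f : RSpace n → ℝ) (x : RSpace n) :
    ddSharp f x ^ n = density f x • omegaTop n :=
  (existsUnique_density f x).choose_spec.1

theorem density_eq {n : ℕ} (f : RSpace n → ℝ) (x : RSpace n) :
    density f x =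
      (n.factorial : ℝ) * (Matrix.of fun i j => partialDeriv i (partialDeriv j f) x).det :=
  (existsUnique_density f x).unique (density_spec f x) (pow_eq_smul_omegaTop _)

end SuperForm

/-- `u` is a sequence of smooth convex functions converging to `f` uniformly on compact sets. -/
structure IsSmoothConvexApprox {n : ℕ} (f : RSpace n → ℝ) (u : ℕ → RSpace n → ℝ) : Prop where
  smooth : ∀ k, ContDiff ℝ ∞ (u k)
  convex : ∀ k, ConvexOn ℝ Set.univ (u k)
  tendsto : ∀ K : Set (RSpace n), IsCompact K → TendstoUniformlyOn u f atTop K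

/-- `μ` is the Monge–Ampère measure `(dd^# f)ⁿ` of the convex function `f`, an `(n,n)`-current
`μ ωₙ` being identified with the measure `μ`: it is locally finite, and `(dd^# uₖ)ⁿ → μ ωₙ`,
tested against continuous functions of compact support, for all smooth convex `uₖ → f`
(of which there is at least one sequence). -/
structure IsMongeAmpere {n : ℕ} (f : RSpace n → ℝ) (μ : Measure (RSpace n)) : Prop where
  locallyFinite : IsLocallyFiniteMeasure μ
  exists_approx : ∃ u, IsSmoothConvexApprox f u
  tendsto : ∀ u, IsSmoothConvexApprox f u →
    ∀ ψ : RSpace n → ℝ, Continuous ψ → HasCompactSupport ψ →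
      Tendsto (fun k => ∫ x, ψ x * SuperForm.density (u k) x) atTop (𝓝 (∫ x, ψ x ∂μ))

theorem IsMongeAmpere.unique {n : ℕ} {f : RSpace n → ℝ} {μ ν : Measure (RSpace n)}
    (hμ : IsMongeAmpere f μ) (hν : IsMongeAmpere f ν) : μ = ν := by
  have := hμ.locallyFinite
  have := hν.locallyFinite
  obtain ⟨u, hu⟩ := hμ.exists_approx
  exact Measure.ext_of_integral_eq_on_compactlySupported fun ψ =>
    tendsto_nhds_unique (hμ.tendsto u hu ψ ψ.continuous ψ.hasCompactSupport)
      (hν.tendsto u hu ψ ψ.continuous ψ.hasCompactSupport)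

open Classical in
/-- The Monge–Ampère measure `(dd^# f)ⁿ` (zero by convention if there is none, which does not
occur for convex `f`). -/
noncomputable def mongeAmpere {n : ℕ} (f : RSpace n → ℝ) : Measure (RSpace n) :=
  if h : ∃ μ, IsMongeAmpere f μ then h.choose else 0

/-- The Lelong class: convex functions on `ℝⁿ` of at most linear growth. -/
def LelongClass (n : ℕ) : Set (RSpace n → ℝ) :=
  {f | ConvexOn ℝ Set.univ f ∧ ∃ C D : ℝ, 0 ≤ C ∧ ∀ x, f x ≤ C * ‖x‖ + D}

/-- `f̃(x) = lim_{t → ∞} f(t x) / t`. -/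
noncomputable def homogenization {n : ℕ} (f : RSpace n → ℝ) (x : RSpace n) : ℝ :=
  limUnder atTop fun t : ℝ => f (t • x) / t

/-!
The Monge–Ampère measure of a convex function `g` is `n!` times the Lebesgue measure of the set of
subgradients: `(dd^# g)ⁿ (E) = n! |∂g(E)|`. So the total mass is `n!` times the volume of the set
`∂g(ℝⁿ)` of the slopes of all affine functions that lie below `g` and touch it
(`ConvexMA.mongeAmpere_univ`), and the theorem compares these sets for `f` and its
homogenization.

The measure is constructed as an image (`ConvexMA.slopeMeasure`). Almost every slope `p` touches
`g` in at most one point: a point touched with slope `p` in a given ball is the gradient at `p` of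
the Legendre transform of `g` restricted to that ball, a Lipschitz function, and Rademacher's
theorem applies (`ConvexMA.ae_isSubgrad_unique`). Choosing a touching point defines an almost
everywhere measurable map on `∂g(ℝⁿ)`, and pushing Lebesgue measure forward along it avoids any
discussion of the additivity of `E ↦ |∂g(E)|`.

For smooth convex `u` the touching point of `p` is a solution of `∇u(x) = p`. The gradient map is
injective where the Hessian is nondegenerate, because its fibres are convex, and the critical
values are negligible by Sard's lemma; the change of variables formula gives
`ConvexMA.integral_mul_density`. If smooth convex `u k` converge to `g` locally uniformly, then for
almost every `p` the touching points converge, or leave every compact set if `p` touches `g`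
nowhere (`ConvexMA.tendsto_indicator_touchPoint`), and dominated convergence yields the weak
convergence of the measures. Mollification shows that approximating sequences exist.

Finally, let `P` be the set of the slopes `p` such that `⟪p, ·⟫` is below the homogenization of
`f`. It is convex and bounded, and it is the set of slopes of the homogenization. Every slope of
`f` lies in `P`, and every interior point of `P` is a slope of `f`, since for such `p` the function
`f - ⟪p, ·⟫` is coercive. As the frontier of a convex set is negligible, the volumes agree.
-/

namespace ConvexMA

open Metric Set

variable {n : ℕ}

/-! ### Subgradients and touching points -/

/-- `p` is a subgradient of `g` at `x`: the affine function of slope `p` through `(x, g x)`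
lies below `g`. -/
def IsSubgrad (g : RSpace n → ℝ) (x p : RSpace n) : Prop :=
  ∀ y, g x + inner ℝ p (y - x) ≤ g y

/-- The set `∂g(S)` of the subgradients of `g` at points of `S`. -/
def subgradImage (g : RSpace n → ℝ) (S : Set (RSpace n)) : Set (RSpace n) :=
  {p | ∃ x ∈ S, IsSubgrad g x p}

open Classical in
/-- A point at which `p` is a subgradient of `g`, and `0` if there is none. For continuous `g`
it is unique for almost every `p`, so that `touchPoint g` is an inverse of `∂g` almost
everywhere. -/
noncomputable def touchPoint (g : RSpace n → ℝ) (p : RSpace n) : RSpace n :=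
  if h : ∃ x, IsSubgrad g x p then h.choose else 0

theorem isSubgrad_touchPoint {g : RSpace n → ℝ} {p : RSpace n}
    (hp : p ∈ subgradImage g univ) : IsSubgrad g (touchPoint g p) p := by
  obtain ⟨x, -, hx⟩ := hp
  have h : ∃ x, IsSubgrad g x p := ⟨x, hx⟩
  rw [touchPoint, dif_pos h]
  exact h.choose_spec

theorem isSubgrad_iff {g : RSpace n → ℝ} {x p : RSpace n} :
    IsSubgrad g x p ↔ ∀ y, g x - inner ℝ p x ≤ g y - inner ℝ p y := by
  refine forall_congr' fun y => ?_
  rw [inner_sub_right]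
  constructor <;> intro h <;> linarith

/-- Subgradients on `closedBall 0 R` are bounded by the oscillation of `g` on
`closedBall 0 (R + 1)`. -/
theorem IsSubgrad.norm_le {g : RSpace n → ℝ} {x p : RSpace n} (h : IsSubgrad g x p) {R M : ℝ}
    (hx : ‖x‖ ≤ R) (hM : ∀ y, ‖y‖ ≤ R + 1 → |g y| ≤ M) : ‖p‖ ≤ 2 * M := by
  have h0 := hM x (by linarith)
  rcases eq_or_ne p 0 with rfl | hp
  · simp only [norm_zero]
    linarith [abs_nonneg (g x)]
  have hpn : ‖p‖ ≠ 0 := norm_ne_zero_iff.2 hp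
  have h1 : ‖‖p‖⁻¹ • p‖ = 1 := by
    rw [norm_smul, norm_inv, norm_norm, inv_mul_cancel₀ hpn]
  have h2 := hM (x + ‖p‖⁻¹ • p) ((norm_add_le _ _).trans (by linarith))
  have h3 := h (x + ‖p‖⁻¹ • p)
  rw [add_sub_cancel_left, inner_smul_right, real_inner_self_eq_norm_sq, sq, ← mul_assoc,
    inv_mul_cancel₀ hpn, one_mul] at h3
  linarith [(abs_le.1 h0).1, (abs_le.1 h2).2]

theorem isClosed_setOf_isSubgrad {g : RSpace n → ℝ} (hg : Continuous g) :
    IsClosed {q : RSpace n × RSpace n | IsSubgrad g q.1 q.2} := by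
  simp only [IsSubgrad, ofPred_forall]
  exact isClosed_iInter fun y => isClosed_le (by fun_prop) (by fun_prop)

theorem isClosed_subgradImage {g : RSpace n → ℝ} (hg : Continuous g) {K : Set (RSpace n)}
    (hK : IsCompact K) : IsClosed (subgradImage g K) := by
  have h : subgradImage g K =
      Prod.snd '' ((K ×ˢ univ) ∩ {q : RSpace n × RSpace n | IsSubgrad g q.1 q.2}) := by
    ext p
    simp [subgradImage]
  rw [h]
  have := isCompact_iff_compactSpace.1 hK
  have h2 : Prod.snd '' ((K ×ˢ univ) ∩ {q : RSpace n × RSpace n | IsSubgrad g q.1 q.2}) =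
      (Prod.snd : K × RSpace n → RSpace n) '' {q | IsSubgrad g q.1 q.2} := by
    ext p
    simp
  rw [h2]
  exact isClosedMap_snd_of_compactSpace _
    ((isClosed_setOf_isSubgrad hg).preimage
      (f := fun q : K × RSpace n => ((q.1 : RSpace n), q.2)) (by fun_prop))

theorem subgradImage_univ_eq_iUnion (g : RSpace n → ℝ) :
    subgradImage g univ = ⋃ R : ℕ, subgradImage g (closedBall 0 R) := by
  ext p
  simp only [subgradImage, mem_univ, true_and, mem_ofPred_eq, mem_iUnion, mem_closedBall_zero_iff]
  constructor
  · rintro ⟨x, hx⟩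
    obtain ⟨R, hR⟩ := exists_nat_ge ‖x‖
    exact ⟨R, x, hR, hx⟩
  · rintro ⟨R, x, -, hx⟩
    exact ⟨x, hx⟩

theorem measurableSet_subgradImage_univ {g : RSpace n → ℝ} (hg : Continuous g) :
    MeasurableSet (subgradImage g univ) := by
  rw [subgradImage_univ_eq_iUnion]
  exact MeasurableSet.iUnion fun R =>
    (isClosed_subgradImage hg (isCompact_closedBall _ _)).measurableSet

theorem exists_abs_le_of_continuous {g : RSpace n → ℝ} (hg : Continuous g) (R : ℝ) :
    ∃ M, ∀ y, ‖y‖ ≤ R → |g y| ≤ M := by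
  obtain ⟨M, hM⟩ := (isCompact_closedBall (0 : RSpace n) R).exists_bound_of_continuousOn
    hg.continuousOn
  exact ⟨M, fun y hy => hM y (mem_closedBall_zero_iff.2 hy)⟩

/-! ### Almost everywhere uniqueness of the touching point -/

/-- The Legendre transform of the restriction of `g` to `closedBall 0 R`. -/
noncomputable def ballConj (g : RSpace n → ℝ) (R : ℝ) (p : RSpace n) : ℝ :=
  sSup ((fun x => inner ℝ p x - g x) '' closedBall 0 R)

theorem le_ballConj {g : RSpace n → ℝ} (hg : Continuous g) {R : ℝ} {x : RSpace n}
    (hx : ‖x‖ ≤ R) (p : RSpace n) : inner ℝ p x - g x ≤ ballConj g R p := by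
  have hbdd : BddAbove ((fun x => inner ℝ p x - g x) '' closedBall 0 R) :=
    ((isCompact_closedBall (0 : RSpace n) R).image (by fun_prop)).bddAbove
  exact le_csSup hbdd ⟨x, mem_closedBall_zero_iff.2 hx, rfl⟩

theorem ballConj_le {g : RSpace n → ℝ} {R : ℝ} (hR : 0 ≤ R) {p : RSpace n} {c : ℝ}
    (h : ∀ x, ‖x‖ ≤ R → inner ℝ p x - g x ≤ c) : ballConj g R p ≤ c := by
  refine csSup_le ((nonempty_closedBall.2 hR).image _) ?_
  rintro _ ⟨x, hx, rfl⟩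
  exact h x (mem_closedBall_zero_iff.1 hx)

theorem lipschitzWith_ballConj {g : RSpace n → ℝ} (hg : Continuous g) (R : ℕ) :
    LipschitzWith (R : NNReal) (ballConj g R) := by
  refine LipschitzWith.of_le_add_mul _ fun p q => ballConj_le (Nat.cast_nonneg R) fun x hx => ?_
  have h1 := le_ballConj hg hx q
  have h2 : inner ℝ (p - q) x ≤ R * dist p q := by
    rw [dist_eq_norm, mul_comm]
    exact (real_inner_le_norm _ _).trans (mul_le_mul_of_nonneg_left hx (norm_nonneg _))
  rw [inner_sub_left] at h2
  simp only [NNReal.coe_natCast]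
  linarith

/-- At a point `x` touched with slope `p`, the function `q ↦ ballConj g R q - ⟪q, x⟫` is minimal
for `q = p`; hence `x` is determined by the differential of `ballConj g R` at `p`. -/
theorem IsSubgrad.eq_gradient_ballConj {g : RSpace n → ℝ} (hg : Continuous g) {R : ℕ}
    {x p : RSpace n} (h : IsSubgrad g x p) (hx : ‖x‖ ≤ R)
    (hd : DifferentiableAt ℝ (ballConj g R) p) : x = gradient (ballConj g R) p := by
  have hmin : IsLocalMin (fun q => ballConj g R q - inner ℝ x q) p := by
    refine Filter.Eventually.of_forall fun q => ?_
    have h1 := le_ballConj hg hx q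
    have h2 : ballConj g R p ≤ inner ℝ p x - g x := by
      refine ballConj_le (Nat.cast_nonneg R) fun y _ => ?_
      linarith [isSubgrad_iff.1 h y]
    simp only [real_inner_comm _ x]
    linarith
  have h0 := hmin.fderiv_eq_zero
  have h3 : HasFDerivAt (fun q => ballConj g R q - inner ℝ x q)
      (fderiv ℝ (ballConj g R) p - innerSL ℝ x) p :=
    hd.hasFDerivAt.sub (innerSL ℝ x).hasFDerivAt
  rw [h3.fderiv, sub_eq_zero] at h0
  rw [gradient, h0]
  exact ((InnerProductSpace.toDual ℝ (RSpace n)).symm_apply_apply x).symm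

theorem ae_differentiableAt_ballConj {g : RSpace n → ℝ} (hg : Continuous g) :
    ∀ᵐ p : RSpace n, ∀ R : ℕ, DifferentiableAt ℝ (ballConj g R) p :=
  ae_all_iff.2 fun R => (lipschitzWith_ballConj hg R).ae_differentiableAt

theorem ae_isSubgrad_unique {g : RSpace n → ℝ} (hg : Continuous g) :
    ∀ᵐ p : RSpace n, ∀ x y, IsSubgrad g x p → IsSubgrad g y p → x = y := by
  filter_upwards [ae_differentiableAt_ballConj hg] with p hp x y hx hy
  obtain ⟨R, hR⟩ := exists_nat_ge (max ‖x‖ ‖y‖)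
  rw [hx.eq_gradient_ballConj hg ((le_max_left _ _).trans hR) (hp R),
    hy.eq_gradient_ballConj hg ((le_max_right _ _).trans hR) (hp R)]

theorem aemeasurable_touchPoint {g : RSpace n → ℝ} (hg : Continuous g) :
    AEMeasurable (touchPoint g) (volume.restrict (subgradImage g univ)) := by
  rw [subgradImage_univ_eq_iUnion, aemeasurable_iUnion_iff]
  intro R
  refine ⟨gradient (ballConj g R), ?_, ?_⟩
  · exact (InnerProductSpace.toDual ℝ (RSpace n)).symm.continuous.measurable.comp
      (measurable_fderiv ℝ _)
  · have hm : MeasurableSet (subgradImage g (closedBall 0 (R : ℝ))) :=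
      (isClosed_subgradImage hg (isCompact_closedBall _ _)).measurableSet
    rw [EventuallyEq, ae_restrict_iff' hm]
    filter_upwards [ae_differentiableAt_ballConj hg, ae_isSubgrad_unique hg] with p hp hu hpR
    obtain ⟨x, hx, hxp⟩ := hpR
    have h := isSubgrad_touchPoint (g := g) ⟨x, mem_univ _, hxp⟩
    rw [hu _ _ h hxp]
    exact hxp.eq_gradient_ballConj hg (mem_closedBall_zero_iff.1 hx) (hp R)

/-! ### The candidate measure -/

/-- The measure `n! · |∂g(·)|`, written as the image of `n!` times Lebesgue measure on the set
`∂g(ℝⁿ)` of all slopes under the inverse `touchPoint g` of `∂g`. -/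
noncomputable def slopeMeasure (g : RSpace n → ℝ) : Measure (RSpace n) :=
  (n.factorial : ENNReal) •
    Measure.map (touchPoint g) (volume.restrict (subgradImage g univ))

theorem slopeMeasure_univ {g : RSpace n → ℝ} (hg : Continuous g) :
    slopeMeasure g univ = n.factorial * volume (subgradImage g univ) := by
  rw [slopeMeasure, Measure.smul_apply,
    Measure.map_apply_of_aemeasurable (aemeasurable_touchPoint hg) MeasurableSet.univ]
  simp

theorem integral_slopeMeasure {g : RSpace n → ℝ} (hg : Continuous g) {ψ : RSpace n → ℝ}
    (hψ : Continuous ψ) :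
    ∫ x, ψ x ∂(slopeMeasure g) =
      n.factorial * ∫ p in subgradImage g univ, ψ (touchPoint g p) := by
  rw [slopeMeasure, integral_smul_measure,
    integral_map (aemeasurable_touchPoint hg) hψ.aestronglyMeasurable]
  simp

theorem isLocallyFiniteMeasure_slopeMeasure {g : RSpace n → ℝ} (hg : Continuous g) :
    IsLocallyFiniteMeasure (slopeMeasure g) := by
  refine ⟨fun x => ⟨ball 0 (‖x‖ + 1), isOpen_ball.mem_nhds (by simp), ?_⟩⟩
  obtain ⟨M, hM⟩ := exists_abs_le_of_continuous hg (‖x‖ + 1 + 1)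
  rw [slopeMeasure, Measure.smul_apply,
    Measure.map_apply_of_aemeasurable (aemeasurable_touchPoint hg) measurableSet_ball,
    Measure.restrict_apply₀' (measurableSet_subgradImage_univ hg).nullMeasurableSet, smul_eq_mul]
  refine ENNReal.mul_lt_top (ENNReal.natCast_lt_top _) (lt_of_le_of_lt (measure_mono ?_)
    (measure_closedBall_lt_top (x := (0 : RSpace n)) (r := 2 * M)))
  rintro p ⟨hp, hp2⟩
  exact mem_closedBall_zero_iff.2 ((isSubgrad_touchPoint hp2).norm_le
    (mem_ball_zero_iff.1 hp).le hM)

/-! ### The gradient map of a smooth convex function -/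

theorem IsSubgrad.eq_gradient {u : RSpace n → ℝ} {x p : RSpace n} (h : IsSubgrad u x p)
    (hd : DifferentiableAt ℝ u x) : p = gradient u x := by
  have hmin : IsLocalMin (fun y => u y - inner ℝ p y) x :=
    Filter.Eventually.of_forall fun y => isSubgrad_iff.1 h y
  have h0 := hmin.fderiv_eq_zero
  have h3 : HasFDerivAt (fun y => u y - inner ℝ p y) (fderiv ℝ u x - innerSL ℝ p) x :=
    hd.hasFDerivAt.sub (innerSL ℝ p).hasFDerivAt
  rw [h3.fderiv, sub_eq_zero] at h0
  rw [gradient, h0]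
  exact ((InnerProductSpace.toDual ℝ (RSpace n)).symm_apply_apply p).symm

theorem isSubgrad_gradient {u : RSpace n → ℝ} (hu : ConvexOn ℝ univ u) {x : RSpace n}
    (hd : DifferentiableAt ℝ u x) : IsSubgrad u x (gradient u x) := by
  intro y
  have hc : ConvexOn ℝ univ (u ∘ AffineMap.lineMap (k := ℝ) x y) := hu.comp_affineMap _
  have hd' : HasDerivAt (u ∘ AffineMap.lineMap (k := ℝ) x y) (fderiv ℝ u x (y - x)) 0 := by
    have h1 : HasFDerivAt u (fderiv ℝ u x) (AffineMap.lineMap (k := ℝ) x y (0 : ℝ)) := by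
      rw [AffineMap.lineMap_apply_zero]
      exact hd.hasFDerivAt
    exact h1.comp_hasDerivAt (0 : ℝ) AffineMap.hasDerivAt_lineMap
  have h2 := hc.le_slope_of_hasDerivAt (mem_univ 0) (mem_univ 1) one_pos hd'
  simp only [slope_def_field, Function.comp_apply, AffineMap.lineMap_apply_zero,
    AffineMap.lineMap_apply_one, sub_zero, div_one] at h2
  have h3 : inner ℝ (gradient u x) (y - x) = fderiv ℝ u x (y - x) := by
    simp [gradient, InnerProductSpace.toDual_symm_apply]
  linarith

theorem isSubgrad_iff_eq_gradient {u : RSpace n → ℝ} (hu : ConvexOn ℝ univ u) {x p : RSpace n}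
    (hd : DifferentiableAt ℝ u x) : IsSubgrad u x p ↔ p = gradient u x :=
  ⟨fun h => h.eq_gradient hd, fun h => h ▸ isSubgrad_gradient hu hd⟩

/-- The set of points touched with a given slope is convex. -/
theorem IsSubgrad.lineMap {u : RSpace n → ℝ} (hu : ConvexOn ℝ univ u) {x y p : RSpace n}
    (hx : IsSubgrad u x p) (hy : IsSubgrad u y p) {t : ℝ} (ht : t ∈ Icc (0 : ℝ) 1) :
    IsSubgrad u (x + t • (y - x)) p := by
  rw [isSubgrad_iff] at *
  intro z
  have h1 := hu.2 (mem_univ x) (mem_univ y) (sub_nonneg.2 ht.2) ht.1 (sub_add_cancel 1 t)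
  have h2 : (1 - t) • x + t • y = x + t • (y - x) := by module
  rw [h2, smul_eq_mul, smul_eq_mul] at h1
  rw [inner_add_right, inner_smul_right, inner_sub_right]
  nlinarith [mul_le_mul_of_nonneg_left (hx z) (sub_nonneg.2 ht.2),
    mul_le_mul_of_nonneg_left (hy z) ht.1]

theorem contDiff_gradient {u : RSpace n → ℝ} (hs : ContDiff ℝ ∞ u) :
    ContDiff ℝ ∞ (gradient u) :=
  (InnerProductSpace.toDual ℝ (RSpace n)).symm.toContinuousLinearEquiv.contDiff.comp
    (hs.fderiv_right (m := ∞) le_rfl)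

theorem inner_fderiv_gradient {u : RSpace n → ℝ} (hs : ContDiff ℝ ∞ u) (x v w : RSpace n) :
    inner ℝ (fderiv ℝ (gradient u) x v) w = fderiv ℝ (fderiv ℝ u) x v w := by
  have hd : DifferentiableAt ℝ (fderiv ℝ u) x :=
    (hs.fderiv_right (m := ∞) le_rfl).differentiable (by simp) x
  have hg := (contDiff_gradient hs).differentiable (by simp) x
  have e : (fun y => inner ℝ (gradient u y) w) = fun y => fderiv ℝ u y w := by
    funext y
    simp [gradient, InnerProductSpace.toDual_symm_apply]
  have h1 := (hg.hasFDerivAt.inner ℝ (hasFDerivAt_const w x)).unique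
    (e ▸ hd.hasFDerivAt.clm_apply (hasFDerivAt_const w x))
  simpa using DFunLike.congr_fun h1 v

theorem toMatrix_fderiv_gradient {u : RSpace n → ℝ} (hs : ContDiff ℝ ∞ u) (x : RSpace n) :
    LinearMap.toMatrix (EuclideanSpace.basisFun (Fin n) ℝ).toBasis
      (EuclideanSpace.basisFun (Fin n) ℝ).toBasis (fderiv ℝ (gradient u) x : _ →ₗ[ℝ] _) =
      Matrix.of fun i j =>
        SuperForm.partialDeriv i (SuperForm.partialDeriv j u) x := by
  have hsymm : IsSymmSndFDerivAt ℝ u x := 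
    (contDiff_infty.1 hs 2).contDiffAt.isSymmSndFDerivAt (by simp)
  have hd : DifferentiableAt ℝ (fderiv ℝ u) x :=
    (hs.fderiv_right (m := ∞) le_rfl).differentiable (by simp) x
  ext i j
  have h1 : SuperForm.partialDeriv i (SuperForm.partialDeriv j u) x =
      fderiv ℝ (fderiv ℝ u) x (EuclideanSpace.single i 1) (EuclideanSpace.single j 1) := by
    have h : HasFDerivAt (SuperForm.partialDeriv j u)
        ((fderiv ℝ (fderiv ℝ u) x).flip (EuclideanSpace.single j 1)) x :=
      (hd.hasFDerivAt.clm_apply (hasFDerivAt_const _ x)).congr_fderiv (by ext; simp)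
    rw [SuperForm.partialDeriv, h.fderiv]
    rfl
  rw [LinearMap.toMatrix_apply, Matrix.of_apply, h1, hsymm.eq, ← inner_fderiv_gradient hs,
    EuclideanSpace.inner_single_right]
  simp

/-- The Hessian of a smooth convex function is positive semidefinite, because the gradient is
monotone. -/
theorem inner_fderiv_gradient_nonneg {u : RSpace n → ℝ} (hu : ConvexOn ℝ univ u)
    (hs : ContDiff ℝ ∞ u) (x v : RSpace n) : 0 ≤ inner ℝ (fderiv ℝ (gradient u) x v) v := by
  have hmono : Monotone fun t : ℝ => inner ℝ (gradient u (x + t • v)) v := by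
    intro s t hst
    have hd := hs.differentiable (by simp)
    have h1 := isSubgrad_gradient hu (hd (x + s • v)) (x + t • v)
    have h2 := isSubgrad_gradient hu (hd (x + t • v)) (x + s • v)
    have e1 : x + t • v - (x + s • v) = (t - s) • v := by module
    have e2 : x + s • v - (x + t • v) = -((t - s) • v) := by module
    rw [e1, inner_smul_right] at h1
    rw [e2, inner_neg_right, inner_smul_right] at h2
    rcases hst.eq_or_lt with rfl | hlt
    · exact le_rfl
    · have : 0 < t - s := sub_pos.2 hlt
      simp only
      nlinarith
  have hg := (contDiff_gradient hs).differentiable (by simp) x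
  have hderiv : HasDerivAt (fun t : ℝ => inner ℝ (gradient u (x + t • v)) v)
      (inner ℝ (fderiv ℝ (gradient u) x v) v) 0 := by
    have hl : HasDerivAt (fun t : ℝ => x + t • v) v 0 := by
      simpa using ((hasDerivAt_id (0 : ℝ)).smul_const v).const_add x
    have h1 : HasFDerivAt (gradient u) (fderiv ℝ (gradient u) x) (x + (0 : ℝ) • v) := by
      simpa using hg.hasFDerivAt
    simpa using (h1.comp_hasDerivAt (0 : ℝ) hl).inner ℝ (hasDerivAt_const (0 : ℝ) v)
  rw [← hderiv.deriv]
  exact hmono.deriv_nonneg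

theorem det_fderiv_gradient_nonneg {u : RSpace n → ℝ} (hu : ConvexOn ℝ univ u)
    (hs : ContDiff ℝ ∞ u) (x : RSpace n) : 0 ≤ (fderiv ℝ (gradient u) x).det := by
  have hsymm : IsSymmSndFDerivAt ℝ u x := 
    (contDiff_infty.1 hs 2).contDiffAt.isSymmSndFDerivAt (by simp)
  have hpos : (fderiv ℝ (gradient u) x : RSpace n →ₗ[ℝ] RSpace n).IsPositive := by
    refine ⟨fun v w => ?_, fun v => ?_⟩
    · change inner ℝ (fderiv ℝ (gradient u) x v) w = inner ℝ v (fderiv ℝ (gradient u) x w)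
      rw [real_inner_comm _ v, inner_fderiv_gradient hs, inner_fderiv_gradient hs, hsymm.eq]
    · exact inner_fderiv_gradient_nonneg hu hs x v
  have h := ((LinearMap.posSemidef_toMatrix_iff
    (EuclideanSpace.basisFun (Fin n) ℝ)).2 hpos).det_nonneg
  rwa [LinearMap.det_toMatrix] at h

theorem density_eq_det {u : RSpace n → ℝ} (hs : ContDiff ℝ ∞ u) (x : RSpace n) :
    SuperForm.density u x = n.factorial * (fderiv ℝ (gradient u) x).det := by
  rw [SuperForm.density_eq, ← toMatrix_fderiv_gradient hs, LinearMap.det_toMatrix]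

/-- A fibre of `∂u` over `p` is convex, so if it has two points then the differential of the
gradient degenerates along the segment joining them. -/
theorem IsSubgrad.eq_of_det_ne_zero {u : RSpace n → ℝ} (hu : ConvexOn ℝ univ u)
    (hs : ContDiff ℝ ∞ u) {x y p : RSpace n} (hx : IsSubgrad u x p) (hy : IsSubgrad u y p)
    (hdet : (fderiv ℝ (gradient u) x).det ≠ 0) : y = x := by
  have hd := hs.differentiable (by simp)
  have hg := (contDiff_gradient hs).differentiable (by simp) x
  have hl : HasDerivAt (fun t : ℝ => x + t • (y - x)) (y - x) 0 := by
    simpa using ((hasDerivAt_id (0 : ℝ)).smul_const (y - x)).const_add x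
  have h1 : HasFDerivAt (gradient u) (fderiv ℝ (gradient u) x) (x + (0 : ℝ) • (y - x)) := by
    simpa using hg.hasFDerivAt
  have h2 := (h1.comp_hasDerivAt (0 : ℝ) hl).hasDerivWithinAt (s := Icc 0 1)
  have h3 : HasDerivWithinAt (fun _ : ℝ => p) (fderiv ℝ (gradient u) x (y - x)) (Icc 0 1) 0 := by
    refine h2.congr (fun t ht => ?_) ?_
    · exact (hx.lineMap hu hy ht).eq_gradient (hd _)
    · exact (hx.lineMap hu hy (left_mem_Icc.2 zero_le_one)).eq_gradient (hd _)
  have h4 : fderiv ℝ (gradient u) x (y - x) = 0 :=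
    (uniqueDiffOn_Icc zero_lt_one 0 (left_mem_Icc.2 zero_le_one)).eq_deriv _ h3
      (hasDerivWithinAt_const _ _ _)
  have hinj : Function.Injective (fderiv ℝ (gradient u) x) :=
    (LinearMap.equivOfDetNeZero (fderiv ℝ (gradient u) x : RSpace n →ₗ[ℝ] RSpace n)
      hdet).injective
  exact sub_eq_zero.1 (hinj (h4.trans (map_zero _).symm))

/-- The change of variables `p = ∇u(x)`: outside the critical set of `∇u` the gradient is
injective, and by Sard's lemma the critical values form a null set. -/
theorem integral_mul_density {u : RSpace n → ℝ} (hu : ConvexOn ℝ univ u)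
    (hs : ContDiff ℝ ∞ u) (ψ : RSpace n → ℝ) :
    ∫ x, ψ x * SuperForm.density u x =
      n.factorial * ∫ p in subgradImage u univ, ψ (touchPoint u p) := by
  have hd := hs.differentiable (by simp)
  have hgC := contDiff_gradient hs
  have hg := hgC.differentiable (by simp)
  have hcont : Continuous fun x => (fderiv ℝ (gradient u) x).det :=
    ContinuousLinearMap.continuous_det.comp (hgC.continuous_fderiv (by simp))
  set s : Set (RSpace n) := {x | (fderiv ℝ (gradient u) x).det ≠ 0} with hsdef
  have hsm : MeasurableSet s := (isOpen_ne.preimage hcont).measurableSet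
  have htouch : ∀ x ∈ s, touchPoint u (gradient u x) = x := fun x hx =>
    (isSubgrad_gradient hu (hd x)).eq_of_det_ne_zero hu hs
      (isSubgrad_touchPoint ⟨x, mem_univ _, isSubgrad_gradient hu (hd x)⟩) hx
  have hinj : InjOn (gradient u) s := fun x hx y hy hxy => by
    rw [← htouch x hx, hxy, htouch y hy]
  have hsard : volume (gradient u '' sᶜ) = 0 :=
    MeasureTheory.addHaar_image_eq_zero_of_det_fderivWithin_eq_zero volume
      (fun x _ => (hg x).hasFDerivAt.hasFDerivWithinAt) fun x hx => not_not.1 hx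
  have hrange : subgradImage u univ = gradient u '' s ∪ gradient u '' sᶜ := by
    rw [← image_union, union_compl_self]
    ext p
    simp only [subgradImage, mem_univ, true_and, mem_ofPred_eq, image_univ, mem_range]
    exact exists_congr fun x => (isSubgrad_iff_eq_gradient hu (hd x)).trans eq_comm
  have hae : subgradImage u univ =ᵐ[volume] gradient u '' s := by
    rw [hrange]
    exact union_ae_eq_left_of_ae_eq_empty (ae_eq_empty.2 hsard)
  rw [setIntegral_congr_set hae, integral_image_eq_integral_abs_det_fderiv_smul volume hsm
    (fun x _ => (hg x).hasFDerivAt.hasFDerivWithinAt) hinj, ← integral_const_mul,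
    ← integral_indicator hsm]
  refine integral_congr_ae (Filter.Eventually.of_forall fun x => ?_)
  simp only [density_eq_det hs]
  by_cases hx : x ∈ s
  · rw [indicator_of_mem hx, htouch x hx, abs_of_nonneg (det_fderiv_gradient_nonneg hu hs x),
      smul_eq_mul]
    ring
  · rw [indicator_of_notMem hx, not_not.1 hx]
    simp

/-! ### Stability of touching points -/

/-- Convexity propagates the inequality `u c + ⟪p, y - c⟫ < u y` outwards along rays. -/
theorem lt_of_forall_sphere_lt {u : RSpace n → ℝ} (hu : ConvexOn ℝ univ u) {c p : RSpace n}
    {r : ℝ} (hr : 0 < r) (h : ∀ y ∈ sphere c r, u c + inner ℝ p (y - c) < u y)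
    {y : RSpace n} (hy : r ≤ dist y c) : u c + inner ℝ p (y - c) < u y := by
  have hd : 0 < dist y c := hr.trans_le hy
  set s := r / dist y c with hs
  have hs0 : 0 < s := div_pos hr hd
  have hs1 : s ≤ 1 := (div_le_one hd).2 hy
  have hmem : c + s • (y - c) ∈ sphere c r := by
    rw [mem_sphere, dist_eq_norm, add_sub_cancel_left, norm_smul, Real.norm_of_nonneg hs0.le,
      ← dist_eq_norm, hs, div_mul_cancel₀ _ hd.ne']
  have h1 := h _ hmem
  have h2 := hu.2 (mem_univ c) (mem_univ y) (sub_nonneg.2 hs1) hs0.le (sub_add_cancel 1 s)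
  have h3 : (1 - s) • c + s • y = c + s • (y - c) := by module
  rw [h3, smul_eq_mul, smul_eq_mul] at h2
  rw [add_sub_cancel_left, inner_smul_right] at h1
  nlinarith

/-- Under the same hypothesis `u - ⟪p, ·⟫` attains its minimum, since its minimum over
`closedBall c r` is a global one. -/
theorem mem_subgradImage_of_forall_sphere_lt {u : RSpace n → ℝ} (hu : ConvexOn ℝ univ u)
    {c p : RSpace n} {r : ℝ} (hr : 0 < r)
    (h : ∀ y ∈ sphere c r, u c + inner ℝ p (y - c) < u y) : p ∈ subgradImage u univ := by
  have hcont : Continuous u := hu.locallyLipschitz.continuous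
  obtain ⟨x, -, hx⟩ := (isCompact_closedBall c r).exists_isMinOn
    (nonempty_closedBall.2 hr.le) (f := fun y => u y - inner ℝ p y) (by fun_prop)
  refine ⟨x, mem_univ _, isSubgrad_iff.2 fun y => ?_⟩
  rcases le_total (dist y c) r with hy | hy
  · exact hx hy
  · have h1 := lt_of_forall_sphere_lt hu hr h hy
    have h2 : u x - inner ℝ p x ≤ u c - inner ℝ p c := hx (mem_closedBall_self hr.le)
    rw [inner_sub_right] at h1
    linarith

theorem IsSubgrad.dist_lt {u : RSpace n → ℝ} (hu : ConvexOn ℝ univ u)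
    {c p x : RSpace n} {r : ℝ} (hr : 0 < r)
    (h : ∀ y ∈ sphere c r, u c + inner ℝ p (y - c) < u y) (hx : IsSubgrad u x p) :
    dist x c < r := by
  by_contra! hc
  have h1 := lt_of_forall_sphere_lt hu hr h hc
  have h2 := isSubgrad_iff.1 hx c
  rw [inner_sub_right] at h1
  linarith

/-- If `g` is touched with slope `p` at `c` only, then for `k` large `u k` is touched with slope
`p`, and only near `c`. -/
theorem eventually_touch_near {g : RSpace n → ℝ} (hg : Continuous g) {u : ℕ → RSpace n → ℝ}
    (hu : IsSmoothConvexApprox g u) {c p : RSpace n} (hc : IsSubgrad g c p)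
    (huniq : ∀ x, IsSubgrad g x p → x = c) {r : ℝ} (hr : 0 < r) :
    ∀ᶠ k in atTop, p ∈ subgradImage (u k) univ ∧ ∀ x, IsSubgrad (u k) x p → dist x c < r := by
  have hpos : ∀ y ∈ sphere c r, 0 < g y - g c - inner ℝ p (y - c) := by
    intro y hy
    have h1 := hc y
    refine lt_of_le_of_ne (by linarith) fun h0 => ?_
    have hy' : y = c := huniq y (isSubgrad_iff.2 fun z => by
      have := isSubgrad_iff.1 hc z
      rw [inner_sub_right] at h0
      linarith)
    rw [hy', mem_sphere, dist_self] at hy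
    exact hr.ne hy
  obtain ⟨δ, hδ, hδle⟩ := (isCompact_sphere c r).exists_forall_le' (by fun_prop) hpos
  have hunif := Metric.tendstoUniformlyOn_iff.1 (hu.tendsto _ (isCompact_closedBall c r)) (δ / 2)
    (half_pos hδ)
  filter_upwards [hunif] with k hk
  have h : ∀ y ∈ sphere c r, u k c + inner ℝ p (y - c) < u k y := by
    intro y hy
    have h1 := (abs_lt.1 (hk c (mem_closedBall_self hr.le))).1
    have h2 := (abs_lt.1 (hk y (sphere_subset_closedBall hy))).2
    linarith [hδle y hy]
  exact ⟨mem_subgradImage_of_forall_sphere_lt (hu.convex k) hr h,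
    fun x hx => hx.dist_lt (hu.convex k) hr h⟩

/-- If `g` is nowhere touched in the compact set `K` with slope `p`, then neither is `u k` for
`k` large: a limit of touching points would be a touching point. -/
theorem eventually_not_touch {g : RSpace n → ℝ} (hg : Continuous g) {u : ℕ → RSpace n → ℝ}
    (hu : IsSmoothConvexApprox g u) {p : RSpace n} {K : Set (RSpace n)} (hK : IsCompact K)
    (hp : p ∉ subgradImage g K) : ∀ᶠ k in atTop, p ∉ subgradImage (u k) K := by
  by_contra hcon
  rw [not_eventually] at hcon
  simp only [not_not] at hcon
  have hne : (atTop ⊓ 𝓟 {k | p ∈ subgradImage (u k) K}).NeBot := by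
    rwa [← frequently_mem_iff_neBot]
  obtain ⟨U, hU⟩ := Ultrafilter.exists_le (atTop ⊓ 𝓟 {k | p ∈ subgradImage (u k) K})
  have hUtop : (U : Filter ℕ) ≤ atTop := hU.trans inf_le_left
  have hUmem : ∀ᶠ k in U, p ∈ subgradImage (u k) K :=
    (hU.trans inf_le_right) (mem_principal_self _)
  have hex : ∀ k, ∃ x, p ∈ subgradImage (u k) K → x ∈ K ∧ IsSubgrad (u k) x p := fun k => by
    by_cases h : p ∈ subgradImage (u k) K
    · obtain ⟨x, hx⟩ := h
      exact ⟨x, fun _ => hx⟩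
    · exact ⟨0, fun h' => absurd h' h⟩
  choose x hx using hex
  have hxK : ∀ᶠ k in U, x k ∈ K := hUmem.mono fun k hk => (hx k hk).1
  obtain ⟨a, haK, ha⟩ := hK.ultrafilter_le_nhds (U.map x) (le_principal_iff.2 hxK)
  have hlim : Tendsto x U (𝓝 a) := ha
  have hval : Tendsto (fun k => u k (x k)) U (𝓝 (g a)) := by
    have h1 : TendstoUniformlyOn u g U K := fun V hV => hUtop (hu.tendsto K hK V hV)
    exact tendsto_comp_of_locally_uniform_limit_within hg.continuousWithinAt
      (tendsto_nhdsWithin_iff.2 ⟨hlim, hxK⟩)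
      fun V hV => ⟨K, self_mem_nhdsWithin, h1 V hV⟩
  refine hp ⟨a, haK, fun y => ?_⟩
  have hy : Tendsto (fun k => u k y) U (𝓝 (g y)) :=
    ((hu.tendsto {y} isCompact_singleton).tendsto_at rfl).mono_left hUtop
  refine le_of_tendsto_of_tendsto (hval.add (tendsto_const_nhds.inner
    (tendsto_const_nhds.sub hlim))) hy ?_
  filter_upwards [hUmem] with k hk
  exact (hx k hk).2 y

/-! ### Weak convergence of the Monge–Ampère measures -/

/-- Almost every slope `p` has at most one touching point on `g`. Either the touching points of
`u k` converge to it, or there is none and those of `u k` leave every compact set. -/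
theorem tendsto_indicator_touchPoint {g : RSpace n → ℝ} (hg : Continuous g)
    {u : ℕ → RSpace n → ℝ} (hu : IsSmoothConvexApprox g u) {ψ : RSpace n → ℝ}
    (hψ : Continuous ψ) (hψc : HasCompactSupport ψ) {p : RSpace n}
    (hp : ∀ x y, IsSubgrad g x p → IsSubgrad g y p → x = y) :
    Tendsto (fun k => (subgradImage (u k) univ).indicator (fun q => ψ (touchPoint (u k) q)) p)
      atTop (𝓝 ((subgradImage g univ).indicator (fun q => ψ (touchPoint g q)) p)) := by
  by_cases hmem : p ∈ subgradImage g univ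
  · rw [indicator_of_mem hmem]
    have hc := isSubgrad_touchPoint hmem
    have huniq : ∀ x, IsSubgrad g x p → x = touchPoint g p := fun x hx => hp _ _ hx hc
    have hlim : Tendsto (fun k => touchPoint (u k) p) atTop (𝓝 (touchPoint g p)) := by
      refine Metric.tendsto_nhds.2 fun r hr => ?_
      filter_upwards [eventually_touch_near hg hu hc huniq hr] with k hk
      exact hk.2 _ (isSubgrad_touchPoint hk.1)
    refine ((hψ.tendsto _).comp hlim).congr' ?_
    filter_upwards [eventually_touch_near hg hu hc huniq one_pos] with k hk
    rw [indicator_of_mem hk.1]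
    rfl
  · rw [indicator_of_notMem hmem]
    have hK : p ∉ subgradImage g (tsupport ψ) := fun ⟨x, _, hx⟩ => hmem ⟨x, mem_univ _, hx⟩
    refine tendsto_const_nhds.congr' ?_
    filter_upwards [eventually_not_touch hg hu hψc hK] with k hk
    by_cases h : p ∈ subgradImage (u k) univ
    · rw [indicator_of_mem h]
      refine (image_eq_zero_of_notMem_tsupport fun hx => hk ⟨_, hx, isSubgrad_touchPoint h⟩).symm
    · rw [indicator_of_notMem h]

theorem tendsto_setIntegral_touchPoint {g : RSpace n → ℝ} (hg : Continuous g)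
    {u : ℕ → RSpace n → ℝ} (hu : IsSmoothConvexApprox g u) {ψ : RSpace n → ℝ}
    (hψ : Continuous ψ) (hψc : HasCompactSupport ψ) :
    Tendsto (fun k => ∫ p in subgradImage (u k) univ, ψ (touchPoint (u k) p)) atTop
      (𝓝 (∫ p in subgradImage g univ, ψ (touchPoint g p))) := by
  have hucont : ∀ k, Continuous (u k) := fun k => (hu.smooth k).continuous
  obtain ⟨R, hR⟩ := hψc.isBounded.subset_closedBall (0 : RSpace n)
  obtain ⟨M, hM⟩ := exists_abs_le_of_continuous hg (R + 1)
  obtain ⟨C, hC⟩ := hψc.exists_bound_of_continuous hψ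
  have hC0 : 0 ≤ C := (norm_nonneg _).trans (hC 0)
  simp only [← integral_indicator (measurableSet_subgradImage_univ (hucont _)),
    ← integral_indicator (measurableSet_subgradImage_univ hg)]
  refine tendsto_integral_filter_of_dominated_convergence
    ((closedBall 0 (2 * (M + 1))).indicator fun _ => C) ?_ ?_ ?_ ?_
  · refine Filter.Eventually.of_forall fun k => ?_
    rw [aestronglyMeasurable_indicator_iff (measurableSet_subgradImage_univ (hucont k))]
    exact (hψ.measurable.comp_aemeasurable
      (aemeasurable_touchPoint (hucont k))).aestronglyMeasurable
  · filter_upwards [Metric.tendstoUniformlyOn_iff.1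
      (hu.tendsto _ (isCompact_closedBall 0 (R + 1))) 1 one_pos] with k hk
    refine Filter.Eventually.of_forall fun p => ?_
    -- Slopes touching `u k` inside the support of `ψ` are bounded independently of `k`.
    by_cases h : p ∈ subgradImage (u k) univ ∧ touchPoint (u k) p ∈ tsupport ψ
    · have hp : p ∈ closedBall (0 : RSpace n) (2 * (M + 1)) := by
        refine mem_closedBall_zero_iff.2 ((isSubgrad_touchPoint h.1).norm_le
          (mem_closedBall_zero_iff.1 (hR h.2)) fun y hy => ?_)
        have h1 := abs_lt.1 (hk y (mem_closedBall_zero_iff.2 hy))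
        have h2 := abs_le.1 (hM y hy)
        exact abs_le.2 ⟨by linarith, by linarith⟩
      rw [indicator_of_mem hp, indicator_of_mem h.1]
      exact hC _
    · have h0 : (subgradImage (u k) univ).indicator (fun q => ψ (touchPoint (u k) q)) p = 0 := by
        by_cases h1 : p ∈ subgradImage (u k) univ
        · rw [indicator_of_mem h1]
          exact image_eq_zero_of_notMem_tsupport fun h2 => h ⟨h1, h2⟩
        · exact indicator_of_notMem h1 _
      rw [h0, norm_zero]
      exact indicator_nonneg (fun _ _ => hC0) p
  · exact (integrable_indicator_iff measurableSet_closedBall).2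
      (integrableOn_const measure_closedBall_lt_top.ne)
  · filter_upwards [ae_isSubgrad_unique hg] with p hp
    exact tendsto_indicator_touchPoint hg hu hψ hψc hp

/-! ### Smooth convex approximations -/

theorem convexOn_normed_convolution {g : RSpace n → ℝ} (hg : ConvexOn ℝ univ g)
    (φ : ContDiffBump (0 : RSpace n)) :
    ConvexOn ℝ univ
      (convolution (φ.normed volume) g (ContinuousLinearMap.lsmul ℝ ℝ) volume) := by
  have hcont : Continuous g := hg.locallyLipschitz.continuous
  have hint : ∀ x, Integrable fun t => φ.normed volume t * g (x - t) := fun x =>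
    (φ.continuous_normed.mul (hcont.comp (continuous_const.sub continuous_id))
      ).integrable_of_hasCompactSupport φ.hasCompactSupport_normed.mul_right
  refine ⟨convex_univ, fun x _ y _ a b ha hb hab => ?_⟩
  simp only [convolution_def, ContinuousLinearMap.lsmul_apply, smul_eq_mul]
  rw [← integral_const_mul, ← integral_const_mul,
    ← integral_add ((hint x).const_mul a) ((hint y).const_mul b)]
  refine integral_mono (hint _) (((hint x).const_mul a).add ((hint y).const_mul b)) fun t => ?_
  have h := hg.2 (mem_univ (x - t)) (mem_univ (y - t)) ha hb hab
  have e : a • (x - t) + b • (y - t) = a • x + b • y - t := by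
    rw [eq_sub_of_add_eq' hab]
    module
  rw [e, smul_eq_mul, smul_eq_mul] at h
  have := mul_le_mul_of_nonneg_left h (φ.nonneg_normed (μ := volume) t)
  simp only
  linarith

theorem exists_isSmoothConvexApprox {g : RSpace n → ℝ} (hg : ConvexOn ℝ univ g) :
    ∃ u, IsSmoothConvexApprox g u := by
  have hcont : Continuous g := hg.locallyLipschitz.continuous
  let φ : ℕ → ContDiffBump (0 : RSpace n) := fun k =>
    ⟨1 / ((k : ℝ) + 1) / 2, 1 / ((k : ℝ) + 1), by positivity,
      half_lt_self Nat.one_div_pos_of_nat⟩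
  refine ⟨fun k => convolution ((φ k).normed volume) g (ContinuousLinearMap.lsmul ℝ ℝ) volume,
    fun k => ?_, fun k => convexOn_normed_convolution hg _, fun K hK => ?_⟩
  · exact (φ k).hasCompactSupport_normed.contDiff_convolution_left _ (φ k).contDiff_normed
      hcont.locallyIntegrable
  · rw [Metric.tendstoUniformlyOn_iff]
    intro ε hε
    obtain ⟨R, hR⟩ := hK.isBounded.subset_closedBall (0 : RSpace n)
    obtain ⟨δ, hδ, hunif⟩ := Metric.uniformContinuousOn_iff.1
      ((isCompact_closedBall (0 : RSpace n) (R + 1)).uniformContinuousOn_of_continuous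
        hcont.continuousOn) (ε / 2) (half_pos hε)
    have hlim := tendsto_one_div_add_atTop_nhds_zero_nat (𝕜 := ℝ)
    filter_upwards [hlim.eventually (gt_mem_nhds hδ), hlim.eventually (gt_mem_nhds one_pos)]
      with k hkδ hk1 x hx
    have hxR := mem_closedBall_zero_iff.1 (hR hx)
    rw [dist_comm]
    refine lt_of_le_of_lt ((φ k).dist_normed_convolution_le hcont.aestronglyMeasurable
      fun y hy => ?_) (half_lt_self hε)
    have hyx : dist y x < 1 / ((k : ℝ) + 1) := hy
    refine (hunif y ?_ x ?_ (hyx.trans hkδ)).le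
    · rw [mem_closedBall_zero_iff]
      have h1 := norm_le_norm_add_norm_sub' y x
      rw [← dist_eq_norm] at h1
      linarith
    · rw [mem_closedBall_zero_iff]
      linarith

theorem isMongeAmpere_slopeMeasure {g : RSpace n → ℝ} (hg : ConvexOn ℝ univ g) :
    IsMongeAmpere g (slopeMeasure g) := by
  have hcont : Continuous g := hg.locallyLipschitz.continuous
  refine ⟨isLocallyFiniteMeasure_slopeMeasure hcont, exists_isSmoothConvexApprox hg,
    fun u hu ψ hψ hψc => ?_⟩
  simp only [integral_mul_density (hu.convex _) (hu.smooth _), integral_slopeMeasure hcont hψ]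
  exact (tendsto_setIntegral_touchPoint hcont hu hψ hψc).const_mul _

theorem isMongeAmpere_mongeAmpere {g : RSpace n → ℝ} (hg : ConvexOn ℝ univ g) :
    IsMongeAmpere g (mongeAmpere g) := by
  have h : ∃ μ, IsMongeAmpere g μ := ⟨_, isMongeAmpere_slopeMeasure hg⟩
  rw [mongeAmpere, dif_pos h]
  exact h.choose_spec

theorem mongeAmpere_univ {g : RSpace n → ℝ} (hg : ConvexOn ℝ univ g) :
    mongeAmpere g univ = n.factorial * volume (subgradImage g univ) := by
  rw [(isMongeAmpere_mongeAmpere hg).unique (isMongeAmpere_slopeMeasure hg),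
    slopeMeasure_univ hg.locallyLipschitz.continuous]

/-! ### The homogenization and its slopes -/

theorem slope_mono_of_convexOn {f : RSpace n → ℝ} (hf : ConvexOn ℝ univ f) (x : RSpace n)
    {s t : ℝ} (hs : 0 < s) (hst : s ≤ t) :
    (f (s • x) - f 0) / s ≤ (f (t • x) - f 0) / t := by
  have ht := hs.trans_le hst
  have h := hf.2 (mem_univ 0) (mem_univ (t • x)) (sub_nonneg.2 ((div_le_one ht).2 hst))
    (div_pos hs ht).le (sub_add_cancel 1 (s / t))
  rw [smul_zero, zero_add, smul_smul, div_mul_cancel₀ _ ht.ne', smul_eq_mul, smul_eq_mul] at h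
  rw [div_le_iff₀ hs]
  have e : (f (t • x) - f 0) / t * s = s / t * f (t • x) - s / t * f 0 := by ring
  linarith

theorem tendsto_homogenization {f : RSpace n → ℝ} (hf : f ∈ LelongClass n) (x : RSpace n) :
    Tendsto (fun t : ℝ => f (t • x) / t) atTop (𝓝 (homogenization f x)) := by
  obtain ⟨hconv, C, D, hC, hD⟩ := hf
  have hmono : Monotone fun t : ℝ => (f (max t 1 • x) - f 0) / max t 1 := fun s t hst =>
    slope_mono_of_convexOn hconv x (one_pos.trans_le (le_max_right _ _)) (max_le_max_right 1 hst)
  have hbdd : BddAbove (range fun t : ℝ => (f (max t 1 • x) - f 0) / max t 1) := by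
    refine ⟨C * ‖x‖ + |D - f 0|, ?_⟩
    rintro _ ⟨t, rfl⟩
    have h1 : 1 ≤ max t 1 := le_max_right _ _
    simp only
    rw [div_le_iff₀ (by linarith)]
    have h2 := hD (max t 1 • x)
    rw [norm_smul, Real.norm_of_nonneg (by linarith)] at h2
    nlinarith [le_abs_self (D - f 0), abs_nonneg (D - f 0)]
  have hlim := tendsto_atTop_ciSup hmono hbdd
  have h0 : Tendsto (fun t : ℝ => f 0 / t) atTop (𝓝 0) := tendsto_const_nhds.div_atTop tendsto_id
  refine tendsto_nhds_limUnder ⟨_, ((hlim.add h0).congr' ?_)⟩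
  filter_upwards [eventually_ge_atTop 1] with t ht
  rw [max_eq_left ht]
  ring

theorem tendsto_slope_homogenization {f : RSpace n → ℝ} (hf : f ∈ LelongClass n) (x : RSpace n) :
    Tendsto (fun t : ℝ => (f (t • x) - f 0) / t) atTop (𝓝 (homogenization f x)) := by
  have h0 : Tendsto (fun t : ℝ => f 0 / t) atTop (𝓝 0) := tendsto_const_nhds.div_atTop tendsto_id
  simpa [sub_div] using (tendsto_homogenization hf x).sub h0

theorem homogenization_zero {f : RSpace n → ℝ} (hf : f ∈ LelongClass n) :
    homogenization f 0 = 0 :=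
  tendsto_nhds_unique (tendsto_homogenization hf 0)
    (by simpa using tendsto_const_nhds.div_atTop tendsto_id)

theorem homogenization_smul {f : RSpace n → ℝ} (hf : f ∈ LelongClass n) {s : ℝ} (hs : 0 < s)
    (x : RSpace n) : homogenization f (s • x) = s * homogenization f x := by
  have h1 := ((tendsto_homogenization hf x).comp (tendsto_id.atTop_mul_const hs)).const_mul s
  refine tendsto_nhds_unique (tendsto_homogenization hf (s • x)) (h1.congr fun t => ?_)
  simp only [Function.comp_apply, id, smul_smul]
  rw [mul_comm t s, ← mul_div_assoc, mul_div_mul_left _ _ hs.ne']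

theorem homogenization_le {f : RSpace n → ℝ} (hf : f ∈ LelongClass n) :
    ∃ C, 0 ≤ C ∧ ∀ x, homogenization f x ≤ C * ‖x‖ := by
  obtain ⟨C, D, hC, hD⟩ := hf.2
  refine ⟨C, hC, fun x => ?_⟩
  have h0 : Tendsto (fun t : ℝ => C * ‖x‖ + D / t) atTop (𝓝 (C * ‖x‖ + 0)) :=
    tendsto_const_nhds.add (tendsto_const_nhds.div_atTop tendsto_id)
  rw [add_zero] at h0
  refine le_of_tendsto_of_tendsto (tendsto_homogenization hf x) h0 ?_
  filter_upwards [eventually_gt_atTop 0] with t ht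
  have h := hD (t • x)
  rw [norm_smul, Real.norm_of_nonneg ht.le] at h
  rw [div_le_iff₀ ht, add_mul, div_mul_cancel₀ _ ht.ne']
  linarith

theorem convexOn_homogenization {f : RSpace n → ℝ} (hf : f ∈ LelongClass n) :
    ConvexOn ℝ univ (homogenization f) := by
  refine ⟨convex_univ, fun x _ y _ a b ha hb hab => ?_⟩
  refine le_of_tendsto_of_tendsto (tendsto_homogenization hf _)
    (((tendsto_homogenization hf x).const_mul a).add
      ((tendsto_homogenization hf y).const_mul b)) ?_
  filter_upwards [eventually_gt_atTop 0] with t ht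
  have h := hf.1.2 (mem_univ (t • x)) (mem_univ (t • y)) ha hb hab
  have e : a • t • x + b • t • y = t • (a • x + b • y) := by module
  rw [e, smul_eq_mul, smul_eq_mul] at h
  rw [div_le_iff₀ ht]
  refine h.trans_eq ?_
  field_simp

/-- The set of the slopes of the linear functions below `g`. If `g` is convex and positively
homogeneous, it is the convex body with support function `g`. -/
def dominatedSlopes (g : RSpace n → ℝ) : Set (RSpace n) :=
  {p | ∀ v, inner ℝ p v ≤ g v}

theorem convex_dominatedSlopes (g : RSpace n → ℝ) : Convex ℝ (dominatedSlopes g) := by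
  intro p hp q hq a b ha hb hab v
  rw [inner_add_left, real_inner_smul_left, real_inner_smul_left]
  calc a * inner ℝ p v + b * inner ℝ q v ≤ a * g v + b * g v :=
        add_le_add (mul_le_mul_of_nonneg_left (hp v) ha) (mul_le_mul_of_nonneg_left (hq v) hb)
    _ = g v := by rw [← add_mul, hab, one_mul]

/-- By homogeneity, an affine function that touches the homogenization anywhere has its linear
part below it, and this linear part touches at the origin. -/
theorem subgradImage_homogenization {f : RSpace n → ℝ} (hf : f ∈ LelongClass n) :
    subgradImage (homogenization f) univ = dominatedSlopes (homogenization f) := by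
  ext p
  constructor
  · rintro ⟨x, -, hx⟩ v
    -- Test the touching inequality at `t v` and let `t → ∞`.
    have h0 : Tendsto (fun t : ℝ => (homogenization f x - inner ℝ p x) / t + inner ℝ p v) atTop
        (𝓝 (0 + inner ℝ p v)) :=
      (tendsto_const_nhds.div_atTop tendsto_id).add tendsto_const_nhds
    rw [zero_add] at h0
    refine le_of_tendsto h0 ?_
    filter_upwards [eventually_gt_atTop 0] with t ht
    have h := isSubgrad_iff.1 hx (t • v)
    rw [homogenization_smul hf ht, inner_smul_right] at h
    rw [← le_sub_iff_add_le, div_le_iff₀ ht]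
    linarith
  · intro hp
    refine ⟨0, mem_univ _, fun y => ?_⟩
    rw [homogenization_zero hf, zero_add, sub_zero]
    exact hp y

/-- An affine function below `f` has its linear part below the homogenization of `f`. -/
theorem subgradImage_subset_dominatedSlopes {f : RSpace n → ℝ} (hf : f ∈ LelongClass n) :
    subgradImage f univ ⊆ dominatedSlopes (homogenization f) := by
  rintro p ⟨x, -, hx⟩ v
  have h0 : Tendsto (fun t : ℝ => (f x - inner ℝ p x) / t + inner ℝ p v) atTop
      (𝓝 (0 + inner ℝ p v)) :=
    (tendsto_const_nhds.div_atTop tendsto_id).add tendsto_const_nhds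
  rw [zero_add] at h0
  refine le_of_tendsto_of_tendsto h0 (tendsto_homogenization hf v) ?_
  filter_upwards [eventually_gt_atTop 0] with t ht
  have h := isSubgrad_iff.1 hx (t • v)
  rw [inner_smul_right] at h
  rw [← le_sub_iff_add_le, ← sub_nonneg]
  have e : f (t • v) / t - inner ℝ p v - (f x - inner ℝ p x) / t =
      (f (t • v) - t * inner ℝ p v - (f x - inner ℝ p x)) / t := by
    field_simp
  rw [e]
  exact div_nonneg (by linarith) ht.le

/-- For `p` in the interior, `f - ⟪p, ·⟫` grows in every direction; by compactness of the unit
sphere it exceeds its value at the origin on a sphere, and hence attains its minimum. -/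
theorem interior_dominatedSlopes_subset {f : RSpace n → ℝ} (hf : f ∈ LelongClass n) :
    interior (dominatedSlopes (homogenization f)) ⊆ subgradImage f univ := by
  intro p hp
  have hcont : Continuous f := hf.1.locallyLipschitz.continuous
  obtain ⟨ε, hε, hball⟩ := Metric.isOpen_iff.1 isOpen_interior p hp
  have hgrow : ∀ v ∈ sphere (0 : RSpace n) 1, inner ℝ p v < homogenization f v := by
    intro v hv
    rw [mem_sphere_zero_iff_norm] at hv
    have hmem : p + (ε / 2) • v ∈ ball p ε := by
      rw [mem_ball, dist_eq_norm, add_sub_cancel_left, norm_smul, hv, mul_one,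
        Real.norm_of_nonneg (half_pos hε).le]
      exact half_lt_self hε
    have h := interior_subset (hball hmem) v
    rw [inner_add_left, real_inner_smul_left, real_inner_self_eq_norm_sq, hv] at h
    linarith
  let U : ℕ → Set (RSpace n) := fun k =>
    {v | inner ℝ p v < (f (((k : ℝ) + 1) • v) - f 0) / ((k : ℝ) + 1)}
  have hUo : ∀ k, IsOpen (U k) := fun k => isOpen_lt (by fun_prop) (by fun_prop)
  have hUmono : Monotone U := fun j k hjk v (hv : _ < _) =>
    lt_of_lt_of_le hv (slope_mono_of_convexOn hf.1 v (by positivity) (by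
      have : (j : ℝ) ≤ k := Nat.cast_le.2 hjk
      linarith))
  have hcover : sphere (0 : RSpace n) 1 ⊆ ⋃ k, U k := by
    intro v hv
    have hlim := (tendsto_slope_homogenization hf v).comp
      (tendsto_atTop_add_const_right atTop (1 : ℝ) tendsto_natCast_atTop_atTop)
    obtain ⟨k, hk⟩ := (hlim.eventually (lt_mem_nhds (hgrow v hv))).exists
    exact mem_iUnion.2 ⟨k, hk⟩
  obtain ⟨k, hk⟩ := (isCompact_sphere (0 : RSpace n) 1).elim_directed_cover U hUo hcover
    hUmono.directed_le
  have hr : (0 : ℝ) < k + 1 := by positivity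
  refine mem_subgradImage_of_forall_sphere_lt hf.1 (c := 0) hr fun y hy => ?_
  rw [mem_sphere_zero_iff_norm] at hy
  have hv : ((k : ℝ) + 1)⁻¹ • y ∈ sphere (0 : RSpace n) 1 := by
    rw [mem_sphere_zero_iff_norm, norm_smul, hy, norm_inv, Real.norm_of_nonneg hr.le,
      inv_mul_cancel₀ hr.ne']
  have h : inner ℝ p (((k : ℝ) + 1)⁻¹ • y) <
      (f (((k : ℝ) + 1) • ((k : ℝ) + 1)⁻¹ • y) - f 0) / ((k : ℝ) + 1) := hk hv
  rw [smul_inv_smul₀ hr.ne', inner_smul_right, inv_mul_eq_div,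
    div_lt_div_iff_of_pos_right hr] at h
  rw [sub_zero]
  linarith

theorem volume_subgradImage_eq {f : RSpace n → ℝ} (hf : f ∈ LelongClass n) :
    volume (subgradImage f univ) = volume (subgradImage (homogenization f) univ) := by
  rw [subgradImage_homogenization hf]
  refine le_antisymm (measure_mono (subgradImage_subset_dominatedSlopes hf)) ?_
  -- The slopes of `f` lie between a convex set and its interior, which differ by a null set.
  rw [← measure_congr (interior_ae_eq_of_null_frontier
    ((convex_dominatedSlopes (homogenization f)).addHaar_frontier volume))]
  exact measure_mono (interior_dominatedSlopes_subset hf)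

theorem volume_subgradImage_lt_top {f : RSpace n → ℝ} (hf : f ∈ LelongClass n) :
    volume (subgradImage f univ) < ⊤ := by
  obtain ⟨C, hC0, hC⟩ := homogenization_le hf
  refine lt_of_le_of_lt (measure_mono ?_)
    (measure_closedBall_lt_top (x := (0 : RSpace n)) (r := C))
  intro p hp
  have h := (subgradImage_subset_dominatedSlopes hf hp p).trans (hC p)
  rw [real_inner_self_eq_norm_sq, sq] at h
  rw [mem_closedBall_zero_iff]
  rcases (norm_nonneg p).eq_or_lt with h0 | h0
  · rwa [← h0]
  · exact le_of_mul_le_mul_right h h0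

end ConvexMA

theorem mainTheorem9 (n : ℕ) (f : EuclideanSpace ℝ (Fin n) → ℝ) (hf : f ∈ LelongClass n) :
    -- the limits defining the homogenization exist
    (∀ x, Tendsto (fun t : ℝ => f (t • x) / t) atTop (𝓝 (homogenization f x))) ∧
    -- the two Monge–Ampère measures are well defined
    IsMongeAmpere f (mongeAmpere f) ∧
    IsMongeAmpere (homogenization f) (mongeAmpere (homogenization f)) ∧
    -- they have the same finite total mass
    mongeAmpere f Set.univ = mongeAmpere (homogenization f) Set.univ ∧
    mongeAmpere f Set.univ < ⊤ := by
  have hh := ConvexMA.convexOn_homogenization hf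
  refine ⟨ConvexMA.tendsto_homogenization hf, ConvexMA.isMongeAmpere_mongeAmpere hf.1,
    ConvexMA.isMongeAmpere_mongeAmpere hh, ?_, ?_⟩
  · rw [ConvexMA.mongeAmpere_univ hf.1, ConvexMA.mongeAmpere_univ hh,
      ConvexMA.volume_subgradImage_eq hf]
  · rw [ConvexMA.mongeAmpere_univ hf.1]
    exact ENNReal.mul_lt_top (ENNReal.natCast_lt_top _) (ConvexMA.volume_subgradImage_lt_top hf)
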